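/- Let $\mathbb{K}$ be a noetherian local commutative ring with maximal ideal $\mathfrak{m}$ and residue field $k=\mathbb{K}/\mathfrak{m}$, and assume that $\mathbb{K}$ is $\mathfrak{m}$-adically complete (a $\mathbb{K}$-module $N$ is called $\mathfrak{m}$-adically complete if the canonical map $N\to\varprojlim_i N/\mathfrak{m}^iN$ is bijective). Let $A$ be an associative unital, not necessarily commutative, $\mathbb{K}$-algebra (the image of $\mathbb{K}$ being central in $A$) that is $\mathfrak{m}$-adically complete as a $\mathbb{K}$-module; neither flatness nor finiteness over $\mathbb{K}$ is assumed. Let $M$ be a perfect complex of left $A$-modules, i.e. an object of the (unbounded) derived category $\mathsf{D}(\mathsf{Mod}\,A)$ that is isomorphic in it to a bounded complex of finitely generated projective $A$-modules. If $k\otimes^{\mathrm{L}}_{\mathbb{K}}M=0$ in $\mathsf{D}(\mathsf{Mod}\,\mathbb{K})$, where $M$ is regarded as a complex of $\mathbb{K}$-modules by restriction of scalars, then $M=0$ in $\mathsf{D}(\mathsf{Mod}\,A)$. -/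

import Mathlib

universe w w₁ w₂ u

namespace DerivedNakayama

open CategoryTheory Limits MonoidalCategory

variable {R : Type u} [CommRing R]

/-- Elementwise acyclicity of the mapping cone of `f`. -/
def ConeExact {N N' : CochainComplex (ModuleCat.{u} R) ℤ} (f : N ⟶ N') : Prop :=
  ∀ (i j k l : ℤ), i + 1 = j → j + 1 = k → k + 1 = l →
    ∀ (x : N.X k) (y : N'.X j), N.d k l x = 0 → N'.d j k y = f.f k x →
      ∃ (v : N.X j) (w : N'.X i), N.d j k v = x ∧ y = f.f j v + N'.d i j w

lemma coneExact_of_quasiIso {N N' : CochainComplex (ModuleCat.{u} R) ℤ} (f : N ⟶ N')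
    [QuasiIso f] : ConeExact f := by
  intro i j k l hij hjk hkl x y hx hy
  have hm : Mono (HomologicalComplex.homologyMap f k) := inferInstance
  have he : Epi (HomologicalComplex.homologyMap f j) := inferInstance
  rw [HomologicalComplex.mono_homologyMap_iff_up_to_refinements f j k l (by simp; omega)
    (by simp; omega)] at hm
  rw [HomologicalComplex.epi_homologyMap_iff_up_to_refinements f i j k (by simp; omega)
    (by simp; omega)] at he
  have key : ∃ v : N.X j, N.d j k v = x := by
    obtain ⟨A', π, hπ, x₁, h⟩ := hm (A := ModuleCat.of R R)
      (ModuleCat.ofHom (LinearMap.toSpanSingleton R _ x))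
      (by ext; simpa using hx)
      (ModuleCat.ofHom (LinearMap.toSpanSingleton R _ y))
      (by ext; simpa using hy.symm)
    obtain ⟨a, ha⟩ := (ModuleCat.epi_iff_surjective π).1 hπ (1 : R)
    have := ConcreteCategory.congr_hom h a
    refine ⟨x₁ a, ?_⟩
    simpa [ha] using this.symm
  obtain ⟨v, hv⟩ := key
  have hz : N'.d j k (y - f.f j v) = 0 := by
    have := ConcreteCategory.congr_hom (f.comm j k) v
    simp only [ModuleCat.comp_apply] at this
    rw [map_sub, hy, this, hv, sub_self]
  obtain ⟨A', π, hπ, x₂, hx₂, y₁, h⟩ := he (A := ModuleCat.of R R)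
      (ModuleCat.ofHom (LinearMap.toSpanSingleton R _ (y - f.f j v)))
      (by ext; simpa using hz)
  obtain ⟨a, ha⟩ := (ModuleCat.epi_iff_surjective π).1 hπ (1 : R)
  have h1 := ConcreteCategory.congr_hom h a
  have h2 := ConcreteCategory.congr_hom hx₂ a
  simp [ha] at h1 h2
  refine ⟨v + x₂ a, y₁ a, ?_, ?_⟩
  · rw [map_add, h2, hv, add_zero]
  · rw [map_add, add_assoc, ← h1]; abel

lemma exists_refinement {A B : ModuleCat.{u} R} (P : A → B → Prop)
    (h : ∀ a, ∃ b, P a b) :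
    ∃ (A' : ModuleCat.{u} R) (π : A' ⟶ A) (_ : Epi π) (g : A' ⟶ B) (s : Set A'),
      Submodule.span R s = ⊤ ∧ ∀ a ∈ s, P (π a) (g a) := by
  choose b hb using h
  refine ⟨ModuleCat.of R (A →₀ R), ModuleCat.ofHom (Finsupp.linearCombination R id), ?_,
    ModuleCat.ofHom (Finsupp.linearCombination R b),
    Set.range (fun a => Finsupp.single a (1 : R)), ?_, ?_⟩
  · rw [ModuleCat.epi_iff_surjective]
    intro a
    exact ⟨Finsupp.single a (1 : R), by simp⟩
  · have h1 := (Finsupp.basisSingleOne (R := R) (ι := A)).span_eq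
    rw [Finsupp.coe_basisSingleOne] at h1
    exact h1
  · rintro _ ⟨a, rfl⟩
    simpa using hb a

lemma quasiIso_of_coneExact {N N' : CochainComplex (ModuleCat.{u} R) ℤ} (f : N ⟶ N')
    (hf : ConeExact f) : QuasiIso f := by
  refine ⟨fun j => ?_⟩
  rw [quasiIsoAt_iff_isIso_homologyMap]
  have hm : Mono (HomologicalComplex.homologyMap f j) := by
    rw [HomologicalComplex.mono_homologyMap_iff_up_to_refinements f (j - 1) j (j + 1) (by simp)
      (by simp)]
    intro A x₂ hx₂ y₁ hy₁
    obtain ⟨A', π, hπ, g, s, hs, h⟩ := exists_refinement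
      (fun (a : A) (b : N.X (j - 1)) => N.d (j - 1) j b = x₂ a) (fun a => by
        obtain ⟨v, w, hv, -⟩ := hf (j - 2) (j - 1) j (j + 1) (by omega) (by omega) rfl (x₂ a) (y₁ a)
          (by simpa using ConcreteCategory.congr_hom hx₂ a)
          (by simpa using (ConcreteCategory.congr_hom hy₁ a).symm)
        exact ⟨v, hv⟩)
    refine ⟨A', π, hπ, g, ?_⟩
    ext1
    refine LinearMap.ext_on hs fun a ha => ?_
    simpa using (h a ha).symm
  have he : Epi (HomologicalComplex.homologyMap f j) := by
    rw [HomologicalComplex.epi_homologyMap_iff_up_to_refinements f (j - 1) j (j + 1) (by simp)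
      (by simp)]
    intro A y₂ hy₂
    obtain ⟨A', π, hπ, g, s, hs, h⟩ := exists_refinement (A := A)
      (B := ModuleCat.of R (N.X j × N'.X (j - 1)))
      (fun (a : A) (b : N.X j × N'.X (j - 1)) => N.d j (j + 1) b.1 = 0 ∧
        y₂ a = f.f j b.1 + N'.d (j - 1) j b.2) (fun a => by
        obtain ⟨v, w, hv, hw⟩ := hf (j - 1) j (j + 1) (j + 2) (by omega) (by omega) (by omega) 0 (y₂ a)
          (by simp)
          (by simpa using (ConcreteCategory.congr_hom hy₂ a))
        exact ⟨(v, w), hv, hw⟩)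
    refine ⟨A', π, hπ, g ≫ ModuleCat.ofHom (LinearMap.fst R _ _), ?_,
      g ≫ ModuleCat.ofHom (LinearMap.snd R _ _), ?_⟩
    · ext1
      refine LinearMap.ext_on hs fun a ha => ?_
      simpa using (h a ha).1
    · ext1
      refine LinearMap.ext_on hs fun a ha => ?_
      simpa using (h a ha).2
  exact isIso_of_mono_of_epi _



section
open HomologicalComplex

variable (P N : CochainComplex (ModuleCat.{u} R) ℤ)

/-- The total tensor product `P ⊗_R N` of two complexes. -/
noncomputable abbrev tens : CochainComplex (ModuleCat.{u} R) ℤ :=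
  mapBifunctor P N (curriedTensor (ModuleCat.{u} R)) (ComplexShape.up ℤ)

variable {N} in
/-- The morphism `P ⊗_R N ⟶ P ⊗_R N'` induced by `f : N ⟶ N'`. -/
noncomputable abbrev tensMap {N' : CochainComplex (ModuleCat.{u} R) ℤ} (f : N ⟶ N') :
    tens P N ⟶ tens P N' :=
  mapBifunctorMap (𝟙 P) f (curriedTensor (ModuleCat.{u} R)) (ComplexShape.up ℤ)

/-- The inclusion of the summand `P^p ⊗_R N^q` in degree `n = p + q`. -/
noncomputable def incl (p q n : ℤ) (h : p + q = n) : P.X p ⊗ N.X q ⟶ (tens P N).X n :=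
  ιMapBifunctor P N (curriedTensor _) (ComplexShape.up ℤ) p q n h

/-- The projection from degree `n` onto the summand `P^p ⊗_R N^q`. -/
noncomputable def proj (p q n : ℤ) : (tens P N).X n ⟶ P.X p ⊗ N.X q :=
  mapBifunctorDesc (K₁ := P) (K₂ := N) (F := curriedTensor _) (c := ComplexShape.up ℤ)
    (fun i j _ => if h : i = p ∧ j = q then eqToHom (by rw [h.1, h.2]; rfl) else 0)

variable {P N} in
lemma tens_hom_ext {n : ℤ} {Y : ModuleCat.{u} R} {f g : (tens P N).X n ⟶ Y}
    (h : ∀ i j h, incl P N i j n h ≫ f = incl P N i j n h ≫ g) : f = g :=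
  mapBifunctor.hom_ext h

lemma incl_proj_self (p q n : ℤ) (h : p + q = n) : incl P N p q n h ≫ proj P N p q n = 𝟙 _ := by
  refine (ι_mapBifunctorDesc _ _ _ _).trans ?_
  simp

lemma incl_proj_self_assoc (p q n : ℤ) (h : p + q = n) {Z : ModuleCat.{u} R}
    (g : P.X p ⊗ N.X q ⟶ Z) : incl P N p q n h ≫ proj P N p q n ≫ g = g := by
  rw [← Category.assoc, incl_proj_self, Category.id_comp]

lemma incl_proj_of_ne (i j p q n : ℤ) (h : i + j = n) (hip : i ≠ p) :
    incl P N i j n h ≫ proj P N p q n = 0 := by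
  refine (ι_mapBifunctorDesc _ _ _ _).trans ?_
  simp [hip]

lemma incl_proj_of_ne_assoc (i j p q n : ℤ) (h : i + j = n) (hip : i ≠ p) {Z : ModuleCat.{u} R}
    (g : P.X p ⊗ N.X q ⟶ Z) : incl P N i j n h ≫ proj P N p q n ≫ g = 0 := by
  rw [← Category.assoc, incl_proj_of_ne _ _ _ _ _ _ _ _ hip, zero_comp]

lemma incl_map {N' : CochainComplex (ModuleCat.{u} R) ℤ} (f : N ⟶ N') (p q n : ℤ) (h : p + q = n) :
    incl P N p q n h ≫ (tensMap P f).f n = (P.X p ◁ f.f q) ≫ incl P N' p q n h := by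
  refine (ι_mapBifunctorMap _ _ _ _ _ _ _ _).trans ?_
  simp
  rfl

lemma incl_d (i j n n' : ℤ) (h : i + j = n) (h' : n + 1 = n') :
    incl P N i j n h ≫ (tens P N).d n n' =
      (P.d i (i + 1) ▷ N.X j) ≫ incl P N (i + 1) j n' (by omega) +
        i.negOnePow • ((P.X i ◁ N.d j (j + 1)) ≫ incl P N i (j + 1) n' (by omega)) := by
  rw [mapBifunctor.d_eq, Preadditive.comp_add]
  unfold incl
  rw [mapBifunctor.ι_D₁, mapBifunctor.ι_D₂,
      mapBifunctor.d₁_eq _ _ _ _ (show (ComplexShape.up ℤ).Rel i (i + 1) by simp) _ _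
        (show i + 1 + j = n' by omega),
      mapBifunctor.d₂_eq _ _ _ _ _ (show (ComplexShape.up ℤ).Rel j (j + 1) by simp) _
        (show i + (j + 1) = n' by omega)]
  simp

lemma map_proj {N' : CochainComplex (ModuleCat.{u} R) ℤ} (f : N ⟶ N') (p q n : ℤ) (h : p + q = n) :
    (tensMap P f).f n ≫ proj P N' p q n = proj P N p q n ≫ (P.X p ◁ f.f q) := by
  refine tens_hom_ext (fun i j hij => ?_)
  rw [← Category.assoc, incl_map, Category.assoc]
  by_cases hip : i = p
  · obtain rfl := hip
    obtain rfl : j = q := by omega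
    rw [incl_proj_self, incl_proj_self_assoc, Category.comp_id]
  · rw [incl_proj_of_ne _ _ _ _ _ _ _ _ hip, incl_proj_of_ne_assoc _ _ _ _ _ _ _ _ hip]
    simp

lemma d_proj (p' p q q' n n' : ℤ) (hp : p' + 1 = p) (hq : q + 1 = q') (h : p + q = n)
    (h' : p + q' = n') :
    (tens P N).d n n' ≫ proj P N p q' n' =
      proj P N p' q' n ≫ (P.d p' p ▷ N.X q') +
        p.negOnePow • (proj P N p q n ≫ (P.X p ◁ N.d q q')) := by
  refine tens_hom_ext (fun i j hij => ?_)
  rw [← Category.assoc, incl_d _ _ _ _ _ _ hij (by omega), Preadditive.add_comp, Preadditive.comp_add,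
    Linear.units_smul_comp, Linear.comp_units_smul, Category.assoc, Category.assoc]
  by_cases h1 : i = p
  · obtain rfl := h1
    obtain rfl : j = q := by omega
    obtain rfl := hq
    rw [incl_proj_of_ne _ _ (i + 1) _ _ _ _ _ (by omega), incl_proj_self,
      incl_proj_of_ne_assoc _ _ _ _ _ _ _ _ (by omega), incl_proj_self_assoc]
    simp
  by_cases h2 : i = p'
  · obtain rfl := h2
    obtain rfl := hp
    obtain rfl : j = q' := by omega
    rw [incl_proj_of_ne _ _ i _ (i + 1) _ _ _ (by omega), incl_proj_self,
      incl_proj_of_ne_assoc _ _ _ _ (i + 1) _ _ _ (by omega), incl_proj_self_assoc]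
    simp
  · rw [incl_proj_of_ne _ _ _ _ _ _ _ _ h1, incl_proj_of_ne _ _ _ _ _ _ _ _ (by omega),
      incl_proj_of_ne_assoc _ _ _ _ _ _ _ _ h1, incl_proj_of_ne_assoc _ _ _ _ _ _ _ _ h2]
    simp

lemma exists_finset_sum (n : ℤ) (t : (tens P N).X n) :
    ∃ S : Finset ℤ, ∀ S', S ⊆ S' → t = ∑ p ∈ S',
      incl P N p (n - p) n (by omega) (proj P N p (n - p) n t) := by
  let U : Submodule R ((tens P N).X n) :=
    { carrier := { t | ∃ S : Finset ℤ, ∀ S', S ⊆ S' → t = ∑ p ∈ S',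
        incl P N p (n - p) n (by omega) (proj P N p (n - p) n t) }
      zero_mem' := ⟨∅, fun S' _ => by simp⟩
      add_mem' := by
        rintro a b ⟨S, hS⟩ ⟨T, hT⟩
        refine ⟨S ∪ T, fun S' h => ?_⟩
        simp only [map_add, Finset.sum_add_distrib]
        rw [← hS S' (Finset.union_subset_left h), ← hT S' (Finset.union_subset_right h)]
      smul_mem' := by
        rintro c a ⟨S, hS⟩
        refine ⟨S, fun S' h => ?_⟩
        simp only [map_smul, ← Finset.smul_sum]
        rw [← hS S' h] }
  have hU : ∀ i j h (s : (P.X i ⊗ N.X j : ModuleCat.{u} R)), incl P N i j n h s ∈ U := by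
    intro i j h s
    obtain rfl : j = n - i := by omega
    refine ⟨{i}, fun S' hS' => ?_⟩
    rw [Finset.sum_eq_single i]
    · have := ConcreteCategory.congr_hom (incl_proj_self P N i (n - i) n h) s
      simp only [ModuleCat.comp_apply, ModuleCat.id_apply] at this
      rw [this]
    · intro b _ hb
      have := ConcreteCategory.congr_hom (incl_proj_of_ne P N i (n - i) b (n - b) n h hb.symm) s
      simp only [ModuleCat.comp_apply] at this
      rw [this]
      simp
    · intro hi
      exact absurd (hS' (by simp)) hi
  have h0 : ModuleCat.ofHom U.mkQ = 0 := by
    refine tens_hom_ext (fun i j h => ?_)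
    ext1
    refine LinearMap.ext fun s => ?_
    simpa using hU i j h s
  have h1 : U.mkQ t = 0 := ConcreteCategory.congr_hom h0 t
  exact (Submodule.Quotient.mk_eq_zero U).1 h1

lemma eq_zero_of_proj (n : ℤ) (t : (tens P N).X n) (h : ∀ p, proj P N p (n - p) n t = 0) :
    t = 0 := by
  obtain ⟨S, hS⟩ := exists_finset_sum P N n t
  rw [hS S subset_rfl]
  simp [h]

lemma exists_bound (n : ℤ) (t : (tens P N).X n) :
    ∃ m : ℤ, ∀ p q, p < m → p + q = n → proj P N p q n t = 0 := by
  obtain ⟨S, hS⟩ := exists_finset_sum P N n t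
  obtain ⟨m, hm⟩ := S.bddBelow
  refine ⟨m, fun p q hp h => ?_⟩
  rw [hS S subset_rfl, map_sum]
  refine Finset.sum_eq_zero fun i hi => ?_
  have hne : i ≠ p := by rintro rfl; exact absurd (hm hi) (by omega)
  simpa using ConcreteCategory.congr_hom (incl_proj_of_ne P N i (n - i) p q n (by omega) hne)
    (proj P N i (n - i) n t)

lemma proj_d_apply (p q q' n n' : ℤ) (hq : q + 1 = q') (h : p + q = n) (h' : p + q' = n')
    (t : (tens P N).X n) (ht : proj P N (p - 1) q' n t = 0) :
    proj P N p q' n' ((tens P N).d n n' t) =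
      p.negOnePow • (P.X p ◁ N.d q q') (proj P N p q n t) := by
  have := ConcreteCategory.congr_hom (d_proj P N (p - 1) p q q' n n' (by omega) hq h h') t
  simp only [ModuleCat.comp_apply] at this
  rw [this]
  simp [ht, Units.smul_def]

lemma proj_map_apply {N' : CochainComplex (ModuleCat.{u} R) ℤ} (f : N ⟶ N') (p q n : ℤ)
    (h : p + q = n) (t : (tens P N).X n) :
    proj P N' p q n ((tensMap P f).f n t) = (P.X p ◁ f.f q) (proj P N p q n t) :=
  ConcreteCategory.congr_hom (map_proj P N f p q n h) t

lemma exists_column (p q n : ℤ) (h : p + q = n) (t : (P.X p ⊗ N.X q : ModuleCat.{u} R)) :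
    ∃ s : (tens P N).X n, proj P N p q n s = t ∧ ∀ p' q', p' ≠ p → proj P N p' q' n s = 0 :=
  ⟨incl P N p q n h t, ConcreteCategory.congr_hom (incl_proj_self P N p q n h) t,
    fun p' q' hne => ConcreteCategory.congr_hom (incl_proj_of_ne P N p q p' q' n h hne.symm) t⟩

lemma d_d_apply (M : CochainComplex (ModuleCat.{u} R) ℤ) (i j k : ℤ) (t : M.X i) :
    M.d j k (M.d i j t) = 0 :=
  ConcreteCategory.congr_hom (M.d_comp_d i j k) t

lemma f_d_apply {M M' : CochainComplex (ModuleCat.{u} R) ℤ} (f : M ⟶ M') (i j : ℤ) (t : M.X i) :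
    M'.d i j (f.f i t) = f.f j (M.d i j t) :=
  ConcreteCategory.congr_hom (f.comm i j) t

lemma sign_sign (p : ℤ) {M : ModuleCat.{u} R} (t : M) : p.negOnePow • p.negOnePow • t = t := by
  rw [smul_smul, Int.units_mul_self, one_smul]

lemma map_sign (p : ℤ) {M M' : ModuleCat.{u} R} (g : M ⟶ M') (t : M) :
    g (p.negOnePow • t) = p.negOnePow • g t := by
  simp [Units.smul_def]

/-- Splitting off one column of the total complex. -/
lemma coneExact_step {N' : CochainComplex (ModuleCat.{u} R) ℤ} (f : N ⟶ N') [QuasiIso f]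
    (m : ℤ) [Module.Flat R (P.X m)] (i j k l : ℤ) (hij : i + 1 = j) (hjk : j + 1 = k)
    (hkl : k + 1 = l) (x : (tens P N).X k) (y : (tens P N').X j)
    (hx : ∀ p q, p < m → p + q = k → proj P N p q k x = 0)
    (hy : ∀ p q, p < m → p + q = j → proj P N' p q j y = 0)
    (hdx : (tens P N).d k l x = 0) (hdy : (tens P N').d j k y = (tensMap P f).f k x) :
    ∃ (v : (tens P N).X j) (w : (tens P N').X i),
      (∀ p q, p < m + 1 → p + q = k → proj P N p q k ((tens P N).d j k v) = proj P N p q k x) ∧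
      (∀ p q, p < m + 1 → p + q = j →
        proj P N' p q j ((tensMap P f).f j v + (tens P N').d i j w) = proj P N' p q j y) := by
  have hcol : ConeExact (((tensorLeft (P.X m)).mapHomologicalComplex _).map f) :=
    coneExact_of_quasiIso _
  have ha0 : (P.X m ◁ N.d (k - m) (l - m)) (proj P N m (k - m) k x) = 0 := by
    have h1 := proj_d_apply P N m (k - m) (l - m) k l (by omega) (by omega) (by omega) x
      (hx _ _ (by omega) (by omega))
    rw [hdx, map_zero] at h1
    rw [← sign_sign m ((P.X m ◁ N.d (k - m) (l - m)) _), ← h1, smul_zero]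
  have hb0 : (P.X m ◁ N'.d (j - m) (k - m)) (m.negOnePow • proj P N' m (j - m) j y) =
      (P.X m ◁ f.f (k - m)) (proj P N m (k - m) k x) := by
    have h1 := proj_d_apply P N' m (j - m) (k - m) j k (by omega) (by omega) (by omega) y
      (hy _ _ (by omega) (by omega))
    rw [hdy, proj_map_apply _ _ _ _ _ _ (by omega)] at h1
    rw [map_sign, ← h1]
  obtain ⟨v₀, w₀, hv₀, hw₀⟩ : ∃ (v₀ : (P.X m ⊗ N.X (j - m) : ModuleCat.{u} R))
      (w₀ : (P.X m ⊗ N'.X (i - m) : ModuleCat.{u} R)),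
      (P.X m ◁ N.d (j - m) (k - m)) v₀ = proj P N m (k - m) k x ∧
      m.negOnePow • proj P N' m (j - m) j y =
        (P.X m ◁ f.f (j - m)) v₀ + (P.X m ◁ N'.d (i - m) (j - m)) w₀ :=
    hcol (i - m) (j - m) (k - m) (l - m) (by omega) (by omega) (by omega) _ _ ha0 hb0
  obtain ⟨v, hv, hv'⟩ := exists_column P N m (j - m) j (by omega) (m.negOnePow • v₀)
  obtain ⟨w, hw, hw'⟩ := exists_column P N' m (i - m) i (by omega) w₀
  refine ⟨v, w, fun p q hp hpq => ?_, fun p q hp hpq => ?_⟩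
  · obtain rfl : q = k - p := by omega
    rw [proj_d_apply P N p (j - p) _ j k (by omega) (by omega) hpq _ (hv' _ _ (by omega))]
    by_cases hpm : p = m
    · obtain rfl := hpm
      rw [hv, map_sign, sign_sign, hv₀]
    · rw [hv' _ _ hpm, map_zero, smul_zero, hx _ _ (by omega) hpq]
  · obtain rfl : q = j - p := by omega
    rw [map_add, proj_map_apply _ _ _ _ _ _ hpq,
      proj_d_apply P N' p (i - p) _ i j (by omega) (by omega) hpq _ (hw' _ _ (by omega))]
    by_cases hpm : p = m
    · obtain rfl := hpm
      rw [hv, hw, map_sign, ← smul_add, ← hw₀, sign_sign]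
    · rw [hv' _ _ hpm, hw' _ _ hpm, map_zero, map_zero, smul_zero, hy _ _ (by omega) hpq, add_zero]

lemma coneExact_tensMap {N' : CochainComplex (ModuleCat.{u} R) ℤ} (f : N ⟶ N') [QuasiIso f]
    [P.IsStrictlyLE 0] [∀ p, Module.Flat R (P.X p)] : ConeExact (tensMap P f) := by
  intro i j k l hij hjk hkl
  have hz (M : CochainComplex (ModuleCat.{u} R) ℤ) (p q : ℤ) (hp : 1 ≤ p)
      (t : (P.X p ⊗ M.X q : ModuleCat.{u} R)) : t = 0 := by
    have h1 : IsZero (P.X p) := P.isZero_of_isStrictlyLE 0 p (by omega)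
    have h2 : IsZero (P.X p ⊗ M.X q) := (tensorRight (M.X q)).map_isZero h1
    have h3 := ModuleCat.subsingleton_of_isZero h2
    exact Subsingleton.elim _ _
  have main : ∀ (c : ℕ) (m : ℤ), m + c = 1 → ∀ (x : (tens P N).X k) (y : (tens P N').X j),
      (∀ p q, p < m → p + q = k → proj P N p q k x = 0) →
      (∀ p q, p < m → p + q = j → proj P N' p q j y = 0) →
      (tens P N).d k l x = 0 → (tens P N').d j k y = (tensMap P f).f k x →
      ∃ (v : (tens P N).X j) (w : (tens P N').X i),
        (tens P N).d j k v = x ∧ y = (tensMap P f).f j v + (tens P N').d i j w := by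
    intro c
    induction c with
    | zero =>
      intro m hm x y hx hy hdx hdy
      have hx0 : x = 0 := eq_zero_of_proj P N k x fun p => by
        by_cases hp : 1 ≤ p
        · exact hz _ _ _ hp _
        · exact hx _ _ (by omega) (by omega)
      have hy0 : y = 0 := eq_zero_of_proj P N' j y fun p => by
        by_cases hp : 1 ≤ p
        · exact hz _ _ _ hp _
        · exact hy _ _ (by omega) (by omega)
      exact ⟨0, 0, by rw [hx0, map_zero], by rw [hy0, map_zero, map_zero, add_zero]⟩
    | succ c ih =>
      intro m hm x y hx hy hdx hdy
      obtain ⟨v₁, w₁, hdv, hdw⟩ :=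
        coneExact_step P N f m i j k l hij hjk hkl x y hx hy hdx hdy
      obtain ⟨v₂, w₂, hv₂, hw₂⟩ := ih (m + 1) (by omega) (x - (tens P N).d j k v₁)
        (y - ((tensMap P f).f j v₁ + (tens P N').d i j w₁))
        (fun p q hp hpq => by rw [map_sub, hdv p q hp hpq, sub_self])
        (fun p q hp hpq => by rw [map_sub, hdw p q hp hpq, sub_self])
        (by rw [map_sub, hdx, d_d_apply, sub_zero])
        (by rw [map_sub, map_add, d_d_apply, add_zero, map_sub, hdy, f_d_apply])
      refine ⟨v₁ + v₂, w₁ + w₂, ?_, ?_⟩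
      · rw [map_add, hv₂, add_sub_cancel]
      · rw [map_add, map_add, add_add_add_comm, ← hw₂, add_sub_cancel]
  intro x y hdx hdy
  obtain ⟨m₁, h₁⟩ := exists_bound P N k x
  obtain ⟨m₂, h₂⟩ := exists_bound P N' j y
  exact main (1 - min 0 (min m₁ m₂)).toNat (min 0 (min m₁ m₂)) (by omega) x y
    (fun p q hp h => h₁ p q (by omega) h) (fun p q hp h => h₂ p q (by omega) h) hdx hdy

end

/-- For a complex `P`, the functor `P ⊗_R -` on complexes of `R`-modules: its value at `N` is the
total complex with terms `⨁_{p + q = n} P^p ⊗_R N^q`. -/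
noncomputable abbrev tensorComplexFunctor (P : CochainComplex (ModuleCat.{u} R) ℤ) :
    CochainComplex (ModuleCat.{u} R) ℤ ⥤ CochainComplex (ModuleCat.{u} R) ℤ :=
  (curriedTensor (ModuleCat.{u} R)).map₂CochainComplex.obj P

instance (P : CochainComplex (ModuleCat.{u} R) ℤ) (p : ℤ) [Projective (P.X p)] :
    Module.Flat R (P.X p) :=
  have : Module.Projective R (P.X p) := (IsProjective.iff_projective _).2 inferInstance
  inferInstance

/-- Tensoring with a bounded above complex of projective modules preserves quasi-isomorphisms. -/
lemma isInvertedBy_tensor (X : ModuleCat.{u} R) [HasDerivedCategory.{w} (ModuleCat.{u} R)] :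
    (HomologicalComplex.quasiIso (ModuleCat.{u} R) (ComplexShape.up ℤ)).IsInvertedBy
      (tensorComplexFunctor (projectiveResolution X).cochainComplex ⋙ DerivedCategory.Q) := by
  intro N N' f hf
  have : QuasiIso f := hf
  have : QuasiIso ((tensorComplexFunctor (projectiveResolution X).cochainComplex).map f) :=
    quasiIso_of_coneExact _ (coneExact_tensMap _ _ f)
  dsimp only [Functor.comp_map]
  infer_instance

/-- The derived tensor product `X ⊗^L_R - : D(Mod R) ⥤ D(Mod R)` with an `R`-module `X`: it is
induced by the functor `N ↦ P ⊗_R N` on complexes, where `P` is a projective resolution of `X`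
(a complex of projective modules concentrated in nonpositive degrees, quasi-isomorphic to `X`). -/
noncomputable def derivedTensor (X : ModuleCat.{u} R) [HasDerivedCategory.{w} (ModuleCat.{u} R)] :
    DerivedCategory (ModuleCat.{u} R) ⥤ DerivedCategory (ModuleCat.{u} R) :=
  Localization.lift
    (tensorComplexFunctor (projectiveResolution X).cochainComplex ⋙ DerivedCategory.Q)
    (isInvertedBy_tensor X) DerivedCategory.Q

section restriction

variable {S : Type u} [Ring S] {T : Type u} [Ring T] (g : S →+* T)

lemma restrictScalars_map_exact (C : ShortComplex (ModuleCat.{u} T)) (h : C.Exact) :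
    (C.map (ModuleCat.restrictScalars.{u} g)).Exact := by
  rw [ShortComplex.ShortExact.moduleCat_exact_iff_function_exact] at h ⊢
  exact h

instance : PreservesFiniteLimits (ModuleCat.restrictScalars.{u} g) := by
  have h := ((Functor.exact_tfae (ModuleCat.restrictScalars.{u} g)).out 1 3).mp
    (restrictScalars_map_exact g)
  exact h.1

instance : PreservesFiniteColimits (ModuleCat.restrictScalars.{u} g) := by
  have h := ((Functor.exact_tfae (ModuleCat.restrictScalars.{u} g)).out 1 3).mp
    (restrictScalars_map_exact g)
  exact h.2

/-- The functor `D(Mod T) ⥤ D(Mod S)` induced by (exact) restriction of scalars along `S → T`. -/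
noncomputable def derivedRestriction [HasDerivedCategory.{w₁} (ModuleCat.{u} S)]
    [HasDerivedCategory.{w₂} (ModuleCat.{u} T)] :
    DerivedCategory (ModuleCat.{u} T) ⥤ DerivedCategory (ModuleCat.{u} S) :=
  (ModuleCat.restrictScalars.{u} g).mapDerivedCategory

end restriction

/-- A complex of left modules over a ring `A` is perfect if, in the derived category, it is
isomorphic to a bounded complex of finitely generated projective modules. -/
def IsPerfect {A : Type u} [Ring A] [HasDerivedCategory.{w} (ModuleCat.{u} A)]
    (M : DerivedCategory (ModuleCat.{u} A)) : Prop :=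
  ∃ P : CochainComplex (ModuleCat.{u} A) ℤ,
    (∃ a b : ℤ, P.IsStrictlyGE a ∧ P.IsStrictlyLE b) ∧
    (∀ i, Module.Finite A (P.X i) ∧ Module.Projective A (P.X i)) ∧
    Nonempty (M ≅ DerivedCategory.Q.obj P)

end DerivedNakayama

/-! Represent `M` by a bounded complex `P` of finitely generated projectives with top degree `b`,
and let `F` be a projective resolution of `k`, so that `F ⊗ P` computes `k ⊗ᴸ M`. As `F` lives in
nonpositive degrees, right exactness of the tensor product shows that vanishing of the cohomology in
degree `b` forces `k ⊗ C = 0`, where `C` is the cokernel of the last differential of `P`; that is,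
`C = 𝔪C` (`tmul_eq_zero_of_exactAt`, `top_le_of_exactAt`).

The module `C` is finitely generated over `A`, though perhaps not over `K`, so Nakayama must be
applied over `A`. Completeness of `A` permits this: for `r ∈ 𝔪` the elements `1 - r • y` are
inverted by geometric series, so `𝔪` maps into the Jacobson radical of `A`
(`algebraMap_mem_jacobson`). Hence `C = 0` and the last differential is surjective
(`surjective_of_top_le`).

Its target is projective, so it splits and its kernel is again finitely generated projective.
Truncating below `b` therefore replaces `P` by a quasi-isomorphic complex of the same kind with one
term fewer, and induction on the length ends at the zero complex. -/

namespace DerivedNakayama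

open CategoryTheory Limits MonoidalCategory

/-! ### The Jacobson radical of an adically complete algebra. -/

section Jacobson

variable {K : Type*} [CommRing K] {A : Type*} [Ring A] [Algebra K A]

lemma mul_mem_smul_top (J : Ideal K) {x : A} (hx : x ∈ (J • ⊤ : Submodule K A)) (y : A) :
    x * y ∈ (J • ⊤ : Submodule K A) := by
  have h := Submodule.mem_map_of_mem (f := LinearMap.mulRight K y) hx
  rw [Submodule.map_smul''] at h
  exact Submodule.smul_mono le_rfl le_top h

/-- The inverse is the sum of the geometric series. -/
lemma exists_mul_one_sub_smul_eq_one (I : Ideal K) [IsAdicComplete I A] {r : K} (hr : r ∈ I)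
    (y : A) : ∃ z : A, z * (1 - r • y) = 1 := by
  have hpow (n : ℕ) : (r • y) ^ n ∈ (I ^ n • ⊤ : Submodule K A) := by
    rw [smul_pow]
    exact Submodule.smul_mem_smul (Ideal.pow_mem_pow hr n) trivial
  obtain ⟨L, hL⟩ := IsPrecomplete.prec (I := I) (M := A) inferInstance
    (f := fun n => ∑ i ∈ Finset.range n, (r • y) ^ i) (by
      intro m n hmn
      rw [SModEq.comm, SModEq.sub_mem, ← Finset.sum_Ico_eq_sub _ hmn]
      refine Submodule.sum_mem _ fun i hi => ?_
      exact Submodule.smul_mono_left (Ideal.pow_le_pow_right (Finset.mem_Ico.1 hi).1) (hpow i))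
  refine ⟨L, ?_⟩
  rw [← sub_eq_zero]
  refine IsHausdorff.haus (I := I) (M := A) inferInstance _ fun n => ?_
  rw [SModEq.zero]
  have h := mul_mem_smul_top (I ^ n) (SModEq.sub_mem.1 (hL n)) (1 - r • y)
  -- With `S` the `n`-th partial sum, `S * (1 - r • y) = 1 - (r • y) ^ n`. So `L * (1 - r • y) - 1`
  -- is the negative of `(S - L) * (1 - r • y) + (r • y) ^ n`, and both summands lie in `I ^ n • ⊤`.
  rw [sub_mul, geom_sum_mul_neg] at h
  convert Submodule.neg_mem _ (Submodule.add_mem _ h (hpow n)) using 1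
  abel

/-- The radical is tested by left inverses of the elements `1 + y * r`. Since `r` is central, these
are `1 - r • (-y)`, which the geometric series inverts. -/
lemma algebraMap_mem_jacobson (I : Ideal K) [IsAdicComplete I A] {r : K} (hr : r ∈ I) :
    algebraMap K A r ∈ Ring.jacobson A := by
  rw [← Ideal.jacobson_bot, Ideal.mem_jacobson_iff]
  intro y
  obtain ⟨z, hz⟩ := exists_mul_one_sub_smul_eq_one I hr (-y)
  refine ⟨z, ?_⟩
  rw [Ideal.mem_bot, sub_eq_zero, ← hz, mul_assoc, ← Algebra.commutes, ← Algebra.smul_def]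
  simp [mul_add, add_comm]

end Jacobson

/-! ### Top cohomology of the derived tensor product. -/

section Top

variable {R : Type u} [CommRing R]

lemma exists_d_eq_of_exactAt {N : CochainComplex (ModuleCat.{u} R) ℤ} {i j k : ℤ}
    (hij : i + 1 = j) (hjk : j + 1 = k) (h : N.ExactAt j) (x : N.X j) (hx : N.d j k x = 0) :
    ∃ y, N.d i j y = x := by
  rw [N.exactAt_iff' i j k (by simp; omega) (by simp; omega),
    ShortComplex.moduleCat_exact_iff] at h
  exact h x hx

/-- Puts the augmentation of a resolution into cohomological indexing. Right exactness at the top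
uses only its surjectivity and the vanishing of its composite with the last differential. -/
lemma exists_augmentation {X : ModuleCat.{u} R} (P : ProjectiveResolution X) :
    ∃ ε : P.cochainComplex.X 0 ⟶ X,
      Function.Surjective ε ∧ P.cochainComplex.d (-1) 0 ≫ ε = 0 := by
  obtain ⟨η, _, hη⟩ : ∃ η : P.complex.X 0 ⟶ X, Epi η ∧ P.complex.d 1 0 ≫ η = 0 :=
    ⟨P.π.f 0, (inferInstance : Epi (P.π.f 0)), P.complex_d_comp_π_f_zero⟩
  refine ⟨(P.cochainComplexXIso 0 0).hom ≫ η, ?_, ?_⟩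
  · rw [← ModuleCat.epi_iff_surjective]
    exact epi_comp _ _
  · rw [P.cochainComplex_d (-1) 0 1 0]
    simp [hη]

/-- Right exactness of the derived tensor product at the top degree of a complex. -/
lemma tmul_eq_zero_of_exactAt {X : ModuleCat.{u} R} (F N : CochainComplex (ModuleCat.{u} R) ℤ)
    [F.IsStrictlyLE 0] (ε : F.X 0 ⟶ X) (hε : Function.Surjective ε) (hdε : F.d (-1) 0 ≫ ε = 0)
    (b : ℤ) [N.IsStrictlyLE b] (h : (tens F N).ExactAt b) (x : X) (z : N.X b) :
    x ⊗ₜ[R] (LinearMap.range (N.d (b - 1) b).hom).mkQ z = 0 := by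
  obtain ⟨e, rfl⟩ := hε x
  have hF : F.d 0 (0 + 1) = 0 :=
    (F.isZero_of_isStrictlyLE 0 (0 + 1) (by omega)).eq_of_tgt _ _
  have hN : N.d b (b + 1) = 0 :=
    (N.isZero_of_isStrictlyLE b (b + 1) (by omega)).eq_of_tgt _ _
  -- The bidegree `(0, b)` is maximal in both variables, so `e ⊗ z` is automatically a cycle.
  have hcycle : (tens F N).d b (b + 1) (incl F N 0 b b (by omega) (e ⊗ₜ z)) = 0 := by
    have h1 := incl_d F N 0 b b (b + 1) (by omega) rfl
    rw [hF, hN] at h1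
    simpa using ConcreteCategory.congr_hom h1 (e ⊗ₜ[R] z)
  obtain ⟨t, ht⟩ := exists_d_eq_of_exactAt (i := b - 1) (by omega) rfl h _ hcycle
  have h2 := ConcreteCategory.congr_hom
    (d_proj F N (-1) 0 (b - 1) b (b - 1) b (by omega) (by omega) (by omega) (by omega)) t
  simp only [ModuleCat.comp_apply] at h2
  rw [ht] at h2
  have h3 : proj F N 0 b b (incl F N 0 b b (by omega) (e ⊗ₜ z)) = e ⊗ₜ z :=
    ConcreteCategory.congr_hom (incl_proj_self F N 0 b b (by omega)) _
  rw [h3] at h2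
  -- The `(0, b)` component of a boundary comes from bidegrees `(-1, b)` and `(0, b - 1)`. The map
  -- `q` kills the first through `ε` and the second through the quotient, so it kills `e ⊗ z`.
  let q : ModuleCat.of R (F.X 0 ⊗ N.X b : ModuleCat.{u} R) →ₗ[R]
      TensorProduct R X (N.X b ⧸ LinearMap.range (N.d (b - 1) b).hom) :=
    TensorProduct.map ε.hom (LinearMap.range (N.d (b - 1) b).hom).mkQ
  have hq₁ (s : (F.X (-1) ⊗ N.X b : ModuleCat.{u} R)) : q ((F.d (-1) 0 ▷ N.X b) s) = 0 := by
    have : q ∘ₗ (F.d (-1) 0 ▷ N.X b).hom = 0 := TensorProduct.ext' fun a c => by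
      have := ConcreteCategory.congr_hom hdε a
      simp only [ModuleCat.comp_apply] at this
      change ε (F.d (-1) 0 a) ⊗ₜ[R] _ = 0
      rw [this]
      exact TensorProduct.zero_tmul _ _
    exact LinearMap.congr_fun this s
  have hq₂ (s : (F.X 0 ⊗ N.X (b - 1) : ModuleCat.{u} R)) :
      q ((F.X 0 ◁ N.d (b - 1) b) s) = 0 := by
    have : q ∘ₗ (F.X 0 ◁ N.d (b - 1) b).hom = 0 := TensorProduct.ext' fun a c => by
      have hc : (LinearMap.range (N.d (b - 1) b).hom).mkQ (N.d (b - 1) b c) = 0 :=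
        (Submodule.Quotient.mk_eq_zero _).2 ⟨c, rfl⟩
      change ε a ⊗ₜ[R] (LinearMap.range (N.d (b - 1) b).hom).mkQ (N.d (b - 1) b c) = 0
      rw [hc, TensorProduct.tmul_zero]
    exact LinearMap.congr_fun this s
  have h4 := congrArg q h2
  refine (h4.trans ?_ : q (e ⊗ₜ z) = 0)
  simpa [hq₁] using hq₂ _

/-- The tensor product of the residue field with the cokernel `C` of the last differential is `C /
𝔪C`, so the vanishing of all `1 ⊗ z` there says `C = 𝔪C`, here pulled back to `N.X b`. -/
lemma top_le_of_exactAt [IsLocalRing R]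
    (P : ProjectiveResolution (ModuleCat.of R (IsLocalRing.ResidueField R)))
    (N : CochainComplex (ModuleCat.{u} R) ℤ) (b : ℤ) [N.IsStrictlyLE b]
    (h : (tens P.cochainComplex N).ExactAt b) :
    ⊤ ≤ IsLocalRing.maximalIdeal R • (⊤ : Submodule R (N.X b)) ⊔
      LinearMap.range (N.d (b - 1) b).hom := by
  intro z _
  set p := LinearMap.range (N.d (b - 1) b).hom
  obtain ⟨ε, hε, hdε⟩ := exists_augmentation P
  have h0 := tmul_eq_zero_of_exactAt _ N ε hε hdε b h (1 : IsLocalRing.ResidueField R) z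
  have h1 := congrArg (TensorProduct.quotTensorEquivQuotSMul (N.X b ⧸ p)
    (IsLocalRing.maximalIdeal R)) h0
  have h2 : (IsLocalRing.maximalIdeal R • (⊤ : Submodule R (N.X b ⧸ p))).mkQ (p.mkQ z) = 0 := by
    refine Eq.trans ?_ (h1.trans (map_zero _))
    exact ((TensorProduct.quotTensorEquivQuotSMul_mk_tmul (IsLocalRing.maximalIdeal R) (1 : R)
      (p.mkQ z)).trans (by simp)).symm
  -- `𝔪C` is the image of `𝔪 • N.X b`, so the class of `z` is represented by some `y` in `𝔪 • N.X
  -- b`.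
  rw [Submodule.mkQ_apply, Submodule.Quotient.mk_eq_zero, ← Submodule.range_mkQ p,
    LinearMap.range_eq_map, ← Submodule.map_smul''] at h2
  obtain ⟨y, hy, hyz⟩ := h2
  rw [← sub_add_cancel z y, add_comm]
  refine Submodule.add_mem_sup hy ?_
  rw [← Submodule.Quotient.mk_eq_zero p, Submodule.Quotient.mk_sub, sub_eq_zero]
  exact hyz.symm

end Top

/-! ### Nakayama's lemma over `A`. -/

section Perfect

variable {K : Type u} [CommRing K] [IsLocalRing K] {A : Type u} [Ring A] [Algebra K A]
  [IsAdicComplete (IsLocalRing.maximalIdeal K) A]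

/-- The cokernel is finitely generated over `A` and equals `𝔪` times itself, hence `Ring.jacobson A`
times itself, so noncommutative Nakayama kills it. -/
lemma surjective_of_top_le {V W : ModuleCat.{u} A} [Module.Finite A W] (f : V ⟶ W)
    (h : ⊤ ≤ IsLocalRing.maximalIdeal K •
        (⊤ : Submodule K ((ModuleCat.restrictScalars (algebraMap K A)).obj W)) ⊔
      LinearMap.range ((ModuleCat.restrictScalars (algebraMap K A)).map f).hom) :
    Function.Surjective f := by
  set p := LinearMap.range f.hom
  have hle : (⊤ : Submodule A (W ⧸ p)) ≤ Ring.jacobson A • ⊤ := by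
    intro q _
    obtain ⟨z, rfl⟩ := p.mkQ_surjective q
    obtain ⟨y, hy, s, ⟨v, rfl⟩, hz⟩ := Submodule.mem_sup.1
      (h (x := (z : (ModuleCat.restrictScalars (algebraMap K A)).obj W)) trivial)
    -- `@id W` reads an element of the restriction of scalars as an element of `W`, so that the
    -- `A`-module structure is found.
    have hz' : z = @id W y + f v := hz.symm
    have hv : p.mkQ (f v) = 0 := (Submodule.Quotient.mk_eq_zero p).2 ⟨v, rfl⟩
    rw [hz', map_add, hv, add_zero]
    clear hz hz'
    refine Submodule.smul_induction_on (p := fun (y : (ModuleCat.restrictScalars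
      (algebraMap K A)).obj W) => p.mkQ (@id W y) ∈ Ring.jacobson A • (⊤ : Submodule A (W ⧸ p)))
      hy (fun r hr n _ => ?_) (fun y₁ y₂ h₁ h₂ => ?_)
    · change p.mkQ (algebraMap K A r • (@id W n)) ∈ _
      rw [map_smul]
      exact Submodule.smul_mem_smul
        (algebraMap_mem_jacobson (IsLocalRing.maximalIdeal K) hr) trivial
    · exact Submodule.add_mem _ h₁ h₂
  have hbot := Submodule.FG.eq_bot_of_le_jacobson_smul Module.Finite.fg_top hle
  refine LinearMap.range_eq_top.1 (Submodule.Quotient.subsingleton_iff.1 ?_)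
  exact (Submodule.subsingleton_iff A).1 (subsingleton_of_bot_eq_top hbot.symm)

end Perfect

/-! ### Shortening a complex of finitely generated projectives. -/

section Truncation

variable {A : Type u} [Ring A]

lemma finite_projective_of_iso {V W : ModuleCat.{u} A} (e : V ≅ W)
    (h : Module.Finite A V ∧ Module.Projective A V) :
    Module.Finite A W ∧ Module.Projective A W := by
  obtain ⟨_, _⟩ := h
  exact ⟨Module.Finite.equiv e.toLinearEquiv, Module.Projective.of_equiv e.toLinearEquiv⟩

/-- A section `s` of `f` exists because `W` is projective; `id - s ∘ f` then retracts `V` onto the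
kernel, which is thus a direct summand of `V`. -/
lemma finite_projective_ker {V W : Type*} [AddCommGroup V] [Module A V] [AddCommGroup W]
    [Module A W] [Module.Finite A V] [Module.Projective A V] [Module.Projective A W]
    (f : V →ₗ[A] W) (hf : Function.Surjective f) :
    Module.Finite A (LinearMap.ker f) ∧ Module.Projective A (LinearMap.ker f) := by
  obtain ⟨s, hs⟩ := Module.projective_lifting_property f LinearMap.id hf
  let r : V →ₗ[A] LinearMap.ker f := LinearMap.codRestrict _ (LinearMap.id - s ∘ₗ f) fun v => by
    have := LinearMap.congr_fun hs (f v)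
    simp only [LinearMap.comp_apply, LinearMap.id_apply] at this
    simp [this]
  have hr : r ∘ₗ (LinearMap.ker f).subtype = LinearMap.id := by
    ext ⟨v, hv⟩
    have : f v = 0 := hv
    simp [r, this]
  exact ⟨Module.Finite.of_surjective r fun x => ⟨x, LinearMap.congr_fun hr x⟩,
    Module.Projective.of_split _ r hr⟩

/-- Removing the top term of a bounded complex that maps onto it. -/
lemma finite_projective_truncLE (P : CochainComplex (ModuleCat.{u} A) ℤ) (c b : ℤ)
    (hcb : c + 1 = b) (hP : ∀ i, Module.Finite A (P.X i) ∧ Module.Projective A (P.X i))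
    (hd : Function.Surjective (P.d c b)) (i : ℤ) :
    Module.Finite A ((P.truncLE c).X i) ∧ Module.Projective A ((P.truncLE c).X i) := by
  rcases lt_trichotomy i c with hi | rfl | hi
  · exact finite_projective_of_iso (P.truncLEXIso c i hi).symm (hP i)
  -- In the cut-off degree the truncation consists of the cycles, i.e. the kernel of the surjection
  -- onto the top term; this is the only term that changes without becoming zero.
  · have e : LinearMap.ker (P.d i b).hom ≃ₗ[A] P.cycles i :=
      ((ModuleCat.kernelIsLimit (P.d i b)).conePointUniqueUpToIso
        (P.cyclesIsKernel i b (by simp; omega))).toLinearEquiv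
    obtain ⟨_, _⟩ := hP i
    obtain ⟨_, _⟩ := hP b
    have := finite_projective_ker (P.d i b).hom hd
    exact finite_projective_of_iso (e.toModuleIso ≪≫ (P.truncLEXIsoCycles i).symm)  this
  · have h0 : IsZero ((P.truncLE c).X i) := (P.truncLE c).isZero_of_isStrictlyLE c i hi
    have := ModuleCat.subsingleton_of_isZero h0
    exact ⟨inferInstance, inferInstance⟩

/-- The truncation embeds termwise into `P`, so the lower bound stays fixed while the upper one
drops. -/
instance isStrictlyGE_truncLE (P : CochainComplex (ModuleCat.{u} A) ℤ) (a c : ℤ)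
    [P.IsStrictlyGE a] : (P.truncLE c).IsStrictlyGE a := by
  rw [CochainComplex.isStrictlyGE_iff]
  intro i hi
  have : Mono ((P.ιTruncLE c).f i) :=
    inferInstanceAs (Mono ((HomologicalComplex.ιTruncLE P (ComplexShape.embeddingUpIntLE c)).f i))
  exact IsZero.of_mono ((P.ιTruncLE c).f i) (P.isZero_of_isStrictlyGE a i hi)

/-- This is the condition under which the inclusion of the truncation at `c` is a quasi-isomorphism:
surjectivity kills the cohomology in degree `b`, and the terms above `b` vanish. -/
lemma isLE_of_surjective (P : CochainComplex (ModuleCat.{u} A) ℤ) (c b : ℤ)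
    (hcb : c + 1 = b) [P.IsStrictlyLE b] (hd : Function.Surjective (P.d c b)) : P.IsLE c := by
  rw [CochainComplex.isLE_iff]
  intro i hi
  by_cases hib : i = b
  · subst hib
    rw [P.exactAt_iff' c i (i + 1) (by simp; omega) (by simp), ShortComplex.moduleCat_exact_iff]
    intro x _
    exact hd x
  · exact ShortComplex.exact_of_isZero_X₂ _ (P.isZero_of_isStrictlyLE b i (by omega))

end Truncation

/-! ### Induction on the length of the complex. -/

section Main

lemma exactAt_of_isZero_Q {C : Type*} [Category C] [Abelian C] [HasDerivedCategory.{w} C]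
    (N : CochainComplex C ℤ) (h : IsZero (DerivedCategory.Q.obj N)) (n : ℤ) : N.ExactAt n := by
  rw [HomologicalComplex.exactAt_iff_isZero_homology]
  exact ((DerivedCategory.homologyFunctor C n).map_isZero h).of_iso
    ((DerivedCategory.homologyFunctorFactors C n).app N).symm

variable {K : Type u} [CommRing K] {A : Type u} [Ring A] [Algebra K A]
  [HasDerivedCategory.{w₁} (ModuleCat.{u} K)] [HasDerivedCategory.{w₂} (ModuleCat.{u} A)]

/-- The derived tensor product of a complex is computed by a projective resolution. -/
noncomputable def derivedTensorObjIso (X : ModuleCat.{u} K)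
    (P : CochainComplex (ModuleCat.{u} A) ℤ) :
    (derivedTensor X).obj ((derivedRestriction (algebraMap K A)).obj (DerivedCategory.Q.obj P)) ≅
      DerivedCategory.Q.obj (tens (projectiveResolution X).cochainComplex
        (((ModuleCat.restrictScalars (algebraMap K A)).mapHomologicalComplex _).obj P)) :=
  (derivedTensor X).mapIso
      ((ModuleCat.restrictScalars (algebraMap K A)).mapDerivedCategoryFactors.app P) ≪≫
    (Localization.fac _ (isInvertedBy_tensor X) DerivedCategory.Q).app _

/-- The number `n` bounds the number of degrees in `[a, b]`; each step lowers `b` by one with `a`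
fixed. -/
lemma isZero_Q_of_isZero_derivedTensor [IsLocalRing K]
    [IsAdicComplete (IsLocalRing.maximalIdeal K) A] (n : ℕ) (a b : ℤ) (hab : b < a + n)
    (P : CochainComplex (ModuleCat.{u} A) ℤ) [P.IsStrictlyGE a] [P.IsStrictlyLE b]
    (hP : ∀ i, Module.Finite A (P.X i) ∧ Module.Projective A (P.X i))
    (h : IsZero ((derivedTensor (ModuleCat.of K (IsLocalRing.ResidueField K))).obj
      ((derivedRestriction (algebraMap K A)).obj (DerivedCategory.Q.obj P)))) :
    IsZero (DerivedCategory.Q.obj P) := by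
  induction n generalizing b P with
  | zero =>
    -- Here `b < a`, so every degree lies below `a` or above `b`.
    refine DerivedCategory.Q.map_isZero ?_
    rw [IsZero.iff_id_eq_zero]
    ext1 i
    by_cases hi : i < a
    · exact (P.isZero_of_isStrictlyGE a i hi).eq_of_src _ _
    · exact (P.isZero_of_isStrictlyLE b i (by omega)).eq_of_src _ _
  | succ n ih =>
    have hN := exactAt_of_isZero_Q _ (h.of_iso (derivedTensorObjIso _ P).symm) b
    have : CochainComplex.IsStrictlyLE (((ModuleCat.restrictScalars
        (algebraMap K A)).mapHomologicalComplex (ComplexShape.up ℤ)).obj P) b := inferInstance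
    have := (hP b).1
    have hd : Function.Surjective (P.d (b - 1) b) :=
      surjective_of_top_le (K := K) _ (top_le_of_exactAt _ _ b hN)
    have := isLE_of_surjective P (b - 1) b (by omega) hd
    -- The truncation is isomorphic to `P` in the derived category, so it inherits the vanishing of
    -- the derived tensor product and its own vanishing passes back to `P`.
    let e := asIso (DerivedCategory.Q.map (P.ιTruncLE (b - 1)))
    refine (ih (b - 1) (by omega) (P.truncLE (b - 1))
      (finite_projective_truncLE P (b - 1) b (by omega) hP hd) ?_).of_iso e.symm
    exact h.of_iso ((derivedTensor _).mapIso ((derivedRestriction (algebraMap K A)).mapIso e))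

end Main

end DerivedNakayama
theorem mainTheorem8 {K : Type u} [CommRing K] [IsLocalRing K] [IsNoetherianRing K]
    [IsAdicComplete (IsLocalRing.maximalIdeal K) K]
    {A : Type u} [Ring A] [Algebra K A] [IsAdicComplete (IsLocalRing.maximalIdeal K) A]
    [HasDerivedCategory.{w₁} (ModuleCat.{u} K)] [HasDerivedCategory.{w₂} (ModuleCat.{u} A)]
    (M : DerivedCategory (ModuleCat.{u} A)) (hM : DerivedNakayama.IsPerfect M)
    (h : CategoryTheory.Limits.IsZero
      ((DerivedNakayama.derivedTensor (ModuleCat.of K (IsLocalRing.ResidueField K))).obj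
        ((DerivedNakayama.derivedRestriction (algebraMap K A)).obj M))) :
    CategoryTheory.Limits.IsZero M := by
  obtain ⟨P, ⟨a, b, _, _⟩, hP, ⟨e⟩⟩ := hM
  -- The length `b - a + 1` is cut off at `0` by `toNat`, which covers an empty range `b < a`.
  refine (DerivedNakayama.isZero_Q_of_isZero_derivedTensor (K := K) (b - a + 1).toNat a b (by omega)
    P hP ?_).of_iso e
  exact h.of_iso ((DerivedNakayama.derivedTensor _).mapIso
    ((DerivedNakayama.derivedRestriction (algebraMap K A)).mapIso e.symm))
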